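/- Let $N,m\ge 1$, $1<p<\infty$, $1/p+1/p'=1$, and let $k>N/2$ be real. Here $H^k(\mathbb R^N)$ is the $L^2$-based Sobolev space of order $k$ (for integer $k$ it is $W^{k,2}(\mathbb R^N)$), and $H^k_{\rm loc}(\mathbb R^N)$ is the set of functions $b$ such that $\chi b\in H^k(\mathbb R^N)$ for all $\chi\in C_0^\infty(\mathbb R^N)$. Let $\mu$ and $\nu$ be Radon measures on $\mathbb R^N$. A singular kernel is a $\mu\times\nu$-measurable function $K(s,t)$ on $\mathbb R^N\times\mathbb R^N$ ($t$ is the variable of $\mu$ and $s$ that of $\nu$) with values in $\mathbb R^m$ which is in $L^2(\mu\times\nu)$ on every compact set disjoint from the diagonal $\{s=t\}$. It is called restrictedly $L^p$ bounded if there is a constant $C$ with $$\Bigl|\int K(s,t) f(t) g(s)\,d\mu(t)\,d\nu(s)\Bigr|\le C\,\|f\|_{L^p(\mu)}\|g\|_{L^{p'}(\nu)}$$ for all bounded Borel functions $f,g:\mathbb R^N\to\mathbb R$ with compact supports at positive distance from each other. **Theorem.** Let $K(s,t)=A(|t-s|)\,B(t-s)$, where * $B:\mathbb R^N\to\mathbb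 R^m$ is continuous, its components belong to $H^k_{\rm loc}(\mathbb R^N)$, it is homogeneous of order $d>0$, i.e. $B(cx)=c^dB(x)$ for all $x\in\mathbb R^N$ and $c>0$, and $\inf_{|x|=1}|B(x)|>0$; * $A$ is a real function with $A(x)\ge x^{-d-\alpha}$ for all $x>0$, for some $\alpha\ge d$. Let $\mu,\nu$ be Radon measures on $\mathbb R^N$ without common atoms such that $K$ is a singular kernel with respect to $\mu$ and $\nu$ and is restrictedly $L^p$ bounded. Then $$\sup_{\mathcal B}\,(\operatorname{diam}\mathcal B)^{-\alpha}\,\mu(\mathcal B)^{1/p'}\,\nu(\mathcal B)^{1/p}<\infty,$$ where the supremum is taken over all (open) balls $\mathcal B$ in $\mathbb R^N$. -/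

import Mathlib

open MeasureTheory
open scoped ENNReal SchwartzMap

/-- The real function `b` on `ℝ^N` is locally in the Sobolev space `H^k = W^{k,2}`: for every smooth
compactly supported cut-off `χ`, the function `χ b` is in `L²` and, as a tempered distribution,
in the Sobolev space `H^k(ℝ^N)` of real order `k`. -/
def MemSobolevLoc {N : ℕ} (k : ℝ) (b : EuclideanSpace ℝ (Fin N) → ℝ) : Prop :=
  ∀ χ : EuclideanSpace ℝ (Fin N) → ℝ, ContDiff ℝ (⊤ : ℕ∞) χ → HasCompactSupport χ →
    ∃ h : MemLp (fun x => ((χ x * b x : ℝ) : ℂ)) 2 volume,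
      TemperedDistribution.MemSobolev k 2
        ((h.toLp : Lp ℂ 2 (volume : Measure (EuclideanSpace ℝ (Fin N)))) :
          𝓢'(EuclideanSpace ℝ (Fin N), ℂ))

/-- `K(s,t)`, with `s` in the space of `ν` and `t` in the space of `μ`, is a singular kernel:
it is measurable (up to null sets) for the product measure, and `L²` for the product measure on
each compact set which does not meet the diagonal. -/
def IsSingularKernel {N m : ℕ} (μ ν : Measure (EuclideanSpace ℝ (Fin N)))
    (K : EuclideanSpace ℝ (Fin N) → EuclideanSpace ℝ (Fin N) → EuclideanSpace ℝ (Fin m)) : Prop :=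
  AEStronglyMeasurable (fun z : EuclideanSpace ℝ (Fin N) × EuclideanSpace ℝ (Fin N) => K z.1 z.2)
      (ν.prod μ) ∧
    ∀ S : Set (EuclideanSpace ℝ (Fin N) × EuclideanSpace ℝ (Fin N)), IsCompact S →
      (∀ z ∈ S, z.1 ≠ z.2) → MemLp (fun z => K z.1 z.2) 2 ((ν.prod μ).restrict S)

/-- Bounded Borel functions `f`, `g` with separated compact supports. -/
structure SeparatedTestPair {N : ℕ} (f g : EuclideanSpace ℝ (Fin N) → ℝ) : Prop where
  measurable_left : Measurable f
  measurable_right : Measurable g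
  bounded_left : ∃ R : ℝ, ∀ x, |f x| ≤ R
  bounded_right : ∃ R : ℝ, ∀ x, |g x| ≤ R
  compact_left : HasCompactSupport f
  compact_right : HasCompactSupport g
  separated : ∃ δ : ℝ, 0 < δ ∧ ∀ x ∈ tsupport f, ∀ y ∈ tsupport g, δ ≤ dist x y

/-- The formal operator with kernel `K` is restrictedly bounded from `L^p(μ)` to `L^p(ν)`
(`q` is the exponent conjugate to `p`). -/
def RestrictedlyBounded {N m : ℕ} (p q : ℝ) (μ ν : Measure (EuclideanSpace ℝ (Fin N)))
    (K : EuclideanSpace ℝ (Fin N) → EuclideanSpace ℝ (Fin N) → EuclideanSpace ℝ (Fin m)) : Prop :=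
  ∃ C : ℝ, ∀ f g : EuclideanSpace ℝ (Fin N) → ℝ, SeparatedTestPair f g →
    ‖∫ z, (f z.2 * g z.1) • K z.1 z.2 ∂(ν.prod μ)‖ ≤
      C * (eLpNorm f (ENNReal.ofReal p) μ).toReal * (eLpNorm g (ENNReal.ofReal q) ν).toReal

/-! Bounded multipliers of the form `a(t) b(s)` can be absorbed into the test functions, so they
preserve restricted boundedness. Cut off to a bounded set, each component of `B` lies in `H^k` with
`k > N/2` and so has an integrable Fourier transform (`exists_integrable_fourierInv_eq`). Then
`B_j(c(t-s))`, cut off, is an integrable superposition of characters of `t-s`, each of which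
factors, and multiplying `K` by it costs a constant independent of `c`
(`norm_integral_fourierInv_smul_le`).

With `c = 1/D` and summation over `j`, homogeneity turns the kernel into the positive scalar `A(|u|)
D^(-d) |B(u)|^2`, `u = t-s`, which is at least `b^2 D^(-α)` for `0 < |u| ≤ D` because `α ≥ d`
(`sum_mul_kernel_ge`). Testing on indicators of disjoint compact `E`, `F` in a ball of diameter `D`
bounds `D^(-α) μ(E)^(1/p') ν(F)^(1/p)`. Since there are no common atoms, `E` and `F` can be chosen
to carry a quarter of the `μ`- and `ν`-mass of the ball. -/

/-! ### Splitting two measures without common atoms -/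

open Set Filter Topology in
/-- A finite measure on the line has a median. -/
theorem exists_median (μ : Measure ℝ) [IsFiniteMeasure μ] :
    ∃ t, μ univ ≤ 2 * μ (Iic t) ∧ μ univ ≤ 2 * μ (Ici t) := by
  rcases eq_or_ne (μ univ) 0 with h0 | h0
  · exact ⟨0, by simp [h0], by simp [h0]⟩
  have hhalf : μ univ / 2 < μ univ := ENNReal.half_lt_self h0 (measure_ne_top _ _)
  have hpos : 0 < μ univ / 2 := ENNReal.half_pos h0
  set S : Set ℝ := {t | μ univ / 2 ≤ μ (Iic t)}
  have hne : S.Nonempty := by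
    obtain ⟨t, ht⟩ := ((tendsto_measure_Iic_atTop μ).eventually (lt_mem_nhds hhalf)).exists
    exact ⟨t, ht.le⟩
  have hbdd : BddBelow S := by
    have hlim := tendsto_measure_iInter_atBot (μ := μ) (s := fun x : ℝ => Iic x)
      (fun n => measurableSet_Iic.nullMeasurableSet) (fun a b hab => Iic_subset_Iic.2 hab)
      ⟨0, measure_ne_top _ _⟩
    rw [iInter_Iic_eq_empty_iff.2 (by simp), measure_empty] at hlim
    obtain ⟨t, ht⟩ := (hlim.eventually (gt_mem_nhds hpos)).exists
    refine ⟨t, fun s hs => ?_⟩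
    by_contra! hlt
    exact absurd (hs.trans (measure_mono (Iic_subset_Iic.2 hlt.le))) (not_le.2 ht)
  have hdouble : ∀ x : ℝ≥0∞, μ univ / 2 ≤ x → μ univ ≤ 2 * x := fun x hx => by
    rw [mul_comm]
    exact (ENNReal.div_le_iff_le_mul (by simp) (by simp)).1 hx
  -- Continuity from above gives both halves: `Iic (sInf S)` is a decreasing limit of half-lines of
  -- at least half mass, and `Ici (sInf S)` one of complements of half-lines of less than half mass.
  refine ⟨sInf S, hdouble _ ?_, hdouble _ ?_⟩
  · obtain ⟨u, hu, hlt, hlim⟩ := exists_seq_strictAnti_tendsto (sInf S)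
    have hI : Iic (sInf S) = ⋂ n, Iic (u n) := by
      ext x
      simp only [mem_Iic, mem_iInter]
      exact ⟨fun h n => h.trans (hlt n).le, fun h => ge_of_tendsto' hlim h⟩
    have := tendsto_measure_iInter_atTop (μ := μ) (s := fun n => Iic (u n))
      (fun n => measurableSet_Iic.nullMeasurableSet)
      (fun a b hab => Iic_subset_Iic.2 (hu.antitone hab)) ⟨0, measure_ne_top _ _⟩
    rw [hI]
    refine ge_of_tendsto' this fun n => ?_
    obtain ⟨s, hs, hsn⟩ := exists_lt_of_csInf_lt hne (hlt n)
    exact le_trans hs (measure_mono (Iic_subset_Iic.2 hsn.le))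
  · obtain ⟨u, hu, hlt, hlim⟩ := exists_seq_strictMono_tendsto (sInf S)
    have hI : Ici (sInf S) = ⋂ n, Ioi (u n) := by
      ext x
      simp only [mem_Ici, mem_iInter, mem_Ioi]
      exact ⟨fun h n => (hlt n).trans_le h, fun h => le_of_tendsto' hlim fun n => (h n).le⟩
    have := tendsto_measure_iInter_atTop (μ := μ) (s := fun n => Ioi (u n))
      (fun n => measurableSet_Ioi.nullMeasurableSet)
      (fun a b hab => Ioi_subset_Ioi (hu.monotone hab)) ⟨0, measure_ne_top _ _⟩
    rw [hI]
    refine ge_of_tendsto' this fun n => ?_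
    have hn : μ (Iic (u n)) < μ univ / 2 := by
      by_contra! h
      exact absurd (csInf_le hbdd h) (not_le.2 (hlt n))
    by_contra! h
    have h1 : μ univ ≤ μ (Iic (u n)) + μ (Ioi (u n)) := by
      rw [← Iic_union_Ioi (a := u n)]
      exact measure_union_le _ _
    have h2 := ENNReal.add_lt_add hn h
    rw [ENNReal.add_halves] at h2
    exact absurd h1 (not_le.2 h2)

open Set in
/-- Two finite measures on the line without common atoms charge substantially two disjoint sets. -/
theorem Real.exists_disjoint_measure_le_two_mul (μ ν : Measure ℝ) [IsFiniteMeasure μ]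
    [IsFiniteMeasure ν] (hatoms : ∀ x, μ {x} = 0 ∨ ν {x} = 0) :
    ∃ E F : Set ℝ, MeasurableSet E ∧ MeasurableSet F ∧ Disjoint E F ∧
      μ univ ≤ 2 * μ E ∧ ν univ ≤ 2 * ν F := by
  obtain ⟨t, h1, h2⟩ := exists_median μ
  have key : ∀ I J : Set ℝ, univ ⊆ I ∪ J → ν univ ≤ 2 * ν I ∨ ν univ ≤ 2 * ν J := by
    intro I J hIJ
    have h := (measure_mono hIJ).trans (measure_union_le (μ := ν) I J)
    rcases le_total (ν I) (ν J) with hle | hle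
    · right
      rw [two_mul]
      exact h.trans (by gcongr)
    · left
      rw [two_mul]
      exact h.trans (by gcongr)
  -- Cut at a median of `μ`: `ν` takes a heavy side and `μ` the opposite one. The point `t` is
  -- removed from the side of a measure that does not charge it.
  rcases hatoms t with h | h
  · have e1 : μ (Iio t) = μ (Iic t) := measure_congr (Iio_ae_eq_Iic' h)
    have e2 : μ (Ioi t) = μ (Ici t) := measure_congr (Ioi_ae_eq_Ici' h)
    rcases key (Iic t) (Ici t) (by simp) with hk | hk
    · exact ⟨Ioi t, Iic t, measurableSet_Ioi, measurableSet_Iic,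
        (Iic_disjoint_Ioi le_rfl).symm, e2 ▸ h2, hk⟩
    · exact ⟨Iio t, Ici t, measurableSet_Iio, measurableSet_Ici,
        (Iio_disjoint_Ici le_rfl), e1 ▸ h1, hk⟩
  · have e1 : ν (Iio t) = ν (Iic t) := measure_congr (Iio_ae_eq_Iic' h)
    rcases key (Iic t) (Ioi t) (by simp) with hk | hk
    · exact ⟨Ici t, Iio t, measurableSet_Ici, measurableSet_Iio,
        (Iio_disjoint_Ici le_rfl).symm, h2, e1 ▸ hk⟩
    · exact ⟨Iic t, Ioi t, measurableSet_Iic, measurableSet_Ioi,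
        (Iic_disjoint_Ioi le_rfl), h1, hk⟩

-- A Borel embedding into the line reduces this to the real case: by injectivity it creates no new
-- atoms.
open Set in
theorem exists_disjoint_measure_le_two_mul {X : Type*} [MeasurableSpace X] [StandardBorelSpace X]
    (μ ν : Measure X) [IsFiniteMeasure μ] [IsFiniteMeasure ν]
    (hatoms : ∀ x, μ {x} = 0 ∨ ν {x} = 0) :
    ∃ E F : Set X, MeasurableSet E ∧ MeasurableSet F ∧ Disjoint E F ∧
      μ univ ≤ 2 * μ E ∧ ν univ ≤ 2 * ν F := by
  have hemb := measurableEmbedding_embeddingReal X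
  obtain ⟨E, F, hE, hF, hd, h1, h2⟩ := Real.exists_disjoint_measure_le_two_mul
    (μ.map (embeddingReal X)) (ν.map (embeddingReal X)) (by
      intro y
      rw [hemb.map_apply, hemb.map_apply]
      rcases (subsingleton_singleton.preimage hemb.injective :
        (embeddingReal X ⁻¹' {y}).Subsingleton).eq_empty_or_singleton with h | ⟨x, h⟩
      · simp [h]
      · rw [h]; exact hatoms x)
  rw [hemb.map_apply, hemb.map_apply, preimage_univ] at h1 h2
  exact ⟨_, _, hemb.measurable hE, hemb.measurable hF, hd.preimage _, h1, h2⟩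

open Set in
/-- A set of finite measure for two measures without common atoms contains two disjoint compact
subsets, each carrying a quarter of the mass of the respective measure. -/
theorem exists_disjoint_isCompact_measure_le_four_mul {X : Type*} [TopologicalSpace X]
    [PolishSpace X] [MeasurableSpace X] [BorelSpace X] (μ ν : Measure X)
    [μ.InnerRegularCompactLTTop] [ν.InnerRegularCompactLTTop] {S : Set X} (hS : MeasurableSet S)
    (hμ : μ S ≠ ∞) (hν : ν S ≠ ∞) (hatoms : ∀ x, μ {x} = 0 ∨ ν {x} = 0) :
    ∃ E F : Set X, IsCompact E ∧ IsCompact F ∧ Disjoint E F ∧ E ⊆ S ∧ F ⊆ S ∧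
      μ S ≤ 4 * μ E ∧ ν S ≤ 4 * ν F := by
  have := isFiniteMeasure_restrict.2 hμ
  have := isFiniteMeasure_restrict.2 hν
  obtain ⟨E, F, hE, hF, hd, h1, h2⟩ := exists_disjoint_measure_le_two_mul
    (μ.restrict S) (ν.restrict S) (fun x => (hatoms x).imp
      (fun h => le_antisymm ((Measure.restrict_apply_le _ _).trans h.le) bot_le)
      (fun h => le_antisymm ((Measure.restrict_apply_le _ _).trans h.le) bot_le))
  rw [Measure.restrict_apply_univ, Measure.restrict_apply hE] at h1
  rw [Measure.restrict_apply_univ, Measure.restrict_apply hF] at h2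
  have key : ∀ (ρ : Measure X) [ρ.InnerRegularCompactLTTop] (A : Set X), MeasurableSet A →
      ρ S ≠ ∞ → ρ S ≤ 2 * ρ (A ∩ S) → ∃ Q ⊆ A ∩ S, IsCompact Q ∧ ρ S ≤ 4 * ρ Q := by
    intro ρ _ A hA hfin h
    rcases eq_or_ne (ρ S) 0 with h0 | h0
    · exact ⟨∅, by simp, by simp, by simp [h0]⟩
    -- Inner regularity needs a strict inequality, so one half is weakened to one quarter.
    have h4 : ρ S / 4 < ρ (A ∩ S) := by
      rw [ENNReal.div_lt_iff (by simp) (by simp)]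
      have hne : ρ (A ∩ S) ≠ ∞ := measure_ne_top_of_subset inter_subset_right hfin
      have hpos : ρ (A ∩ S) ≠ 0 := fun h' => h0 (by simpa [h'] using h)
      refine h.trans_lt ?_
      rw [mul_comm]
      exact (ENNReal.mul_lt_mul_iff_right hpos hne).2 (by norm_num)
    obtain ⟨Q, hQ, hQc, hlt⟩ := (hA.inter hS).exists_lt_isCompact_of_ne_top
      (measure_ne_top_of_subset inter_subset_right hfin) h4
    refine ⟨Q, hQ, hQc, ?_⟩
    rw [mul_comm]
    exact (ENNReal.div_le_iff_le_mul (by simp) (by simp)).1 hlt.le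
  obtain ⟨E', hE', hcE, hmE⟩ := key μ E hE hμ h1
  obtain ⟨F', hF', hcF, hmF⟩ := key ν F hF hν h2
  exact ⟨E', F', hcE, hcF, hd.mono (hE'.trans inter_subset_left) (hF'.trans inter_subset_left),
    hE'.trans inter_subset_right, hF'.trans inter_subset_right, hmE, hmF⟩

/-! ### Sobolev functions and integrable Fourier transforms -/

open FourierTransform in
/-- A continuous function of order of smoothness `k > N / 2` in the `L²`-Sobolev scale is the
inverse Fourier transform of an integrable function. -/
theorem exists_integrable_fourierInv_eq {N : ℕ} {k : ℝ} (hk : (N : ℝ) / 2 < k)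
    {f : EuclideanSpace ℝ (Fin N) → ℂ} (hf : Continuous f) (hf2 : MemLp f 2 volume)
    (hsob : TemperedDistribution.MemSobolev k 2
      ((hf2.toLp : Lp ℂ 2 (volume : Measure (EuclideanSpace ℝ (Fin N)))) :
        𝓢'(EuclideanSpace ℝ (Fin N), ℂ))) :
    ∃ v : EuclideanSpace ℝ (Fin N) → ℂ, Integrable v ∧ 𝓕⁻ v = f := by
  -- Cauchy–Schwarz: `(1+|ξ|^2)^(-k/2)` is square integrable for `k > N/2`.
  obtain ⟨v, hv⟩ := hsob.fourier_memL1 (by rw [finrank_euclideanSpace_fin]; linarith)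
  have hvi : Integrable v := L1.integrable_coeFn v
  have hcont : Continuous (𝓕⁻ (v : EuclideanSpace ℝ (Fin N) → ℂ)) :=
    VectorFourier.fourierIntegral_continuous Real.continuous_fourierChar
      (L := -innerₗ (EuclideanSpace ℝ (Fin N))) (by simpa using! continuous_inner.neg) hvi
  -- Both functions are continuous, so equality as distributions suffices.
  refine ⟨v, hvi, (Continuous.ae_eq_iff_eq volume hcont hf).1 ?_⟩
  refine ae_eq_of_integral_contDiff_smul_eq hcont.locallyIntegrable hf.locallyIntegrable ?_
  intro g hg hgc
  have hgc' : HasCompactSupport (fun x => (g x : ℂ)) := hgc.comp_left (g := Complex.ofReal) rfl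
  have hg' : ContDiff ℝ (⊤ : ℕ∞) (fun x => (g x : ℂ)) := Complex.ofRealCLM.contDiff.comp hg
  set G : 𝓢(EuclideanSpace ℝ (Fin N), ℂ) := hgc'.toSchwartzMap hg'
  have hG : ∀ x, G x = (g x : ℂ) := fun x => rfl
  have h1 := congrArg (fun T : 𝓢'(EuclideanSpace ℝ (Fin N), ℂ) => T (𝓕⁻ G)) hv
  simp only [TemperedDistribution.fourier_apply, FourierTransform.fourier_fourierInv_eq,
    Lp.toTemperedDistribution_apply] at h1
  have h2 : ∫ x, G x • (hf2.toLp f : EuclideanSpace ℝ (Fin N) → ℂ) x = ∫ x, g x • f x := by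
    refine integral_congr_ae ?_
    filter_upwards [hf2.coeFn_toLp] with x hx
    rw [hx, hG, Complex.real_smul, smul_eq_mul]
  have h3 : ∫ x, (𝓕⁻ G) x • v x = ∫ x, G x • (𝓕⁻ (v : EuclideanSpace ℝ (Fin N) → ℂ)) x := by
    rw [SchwartzMap.fourierInv_coe]
    have := VectorFourier.integral_fourierIntegral_smul_eq_flip
      (L := -innerₗ (EuclideanSpace ℝ (Fin N))) (μ := volume) (ν := volume) (f := G) (g := v)
      Real.continuous_fourierChar (by simpa using! continuous_inner.neg) G.integrable hvi
    convert! this using 4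
    simp [Real.fourierInv_eq, VectorFourier.fourierIntegral, real_inner_comm]
  rw [← h2, h1, h3]
  simp [hG]

/-- The inverse Fourier transform of a function which is real at a point, written out in sines
and cosines. -/
theorem ofReal_eq_fourierInv {V : Type*} [NormedAddCommGroup V] [InnerProductSpace ℝ V]
    [MeasurableSpace V] [BorelSpace V] [FiniteDimensional ℝ V] {v : V → ℂ} (hv : Integrable v)
    {x : V} {a : ℝ} (h : FourierTransformInv.fourierInv v x = (a : ℂ)) :
    a = ∫ ξ, ((v ξ).re * Real.cos (2 * Real.pi * inner ℝ ξ x) -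
      (v ξ).im * Real.sin (2 * Real.pi * inner ℝ ξ x)) := by
  have hI : Integrable fun ξ => Complex.exp (↑(2 * Real.pi * inner ℝ ξ x) * Complex.I) • v ξ := by
    refine hv.bdd_smul (𝕜 := ℂ) 1 ?_ ?_
    · exact (by fun_prop : Continuous fun ξ : V =>
        Complex.exp (↑(2 * Real.pi * inner ℝ ξ x) * Complex.I)).aestronglyMeasurable
    · exact ae_of_all _ fun ξ => (Complex.norm_exp_ofReal_mul_I _).le
  rw [Real.fourierInv_eq'] at h
  have h' := congrArg Complex.re h
  rw [Complex.ofReal_re] at h'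
  rw [← h', ← RCLike.re_eq_complex_re, ← integral_re hI]
  refine integral_congr_ae (ae_of_all _ fun ξ => ?_)
  simp only [RCLike.re_eq_complex_re, smul_eq_mul, Complex.mul_re, Complex.exp_ofReal_mul_I_re,
    Complex.exp_ofReal_mul_I_im]
  ring

/-! ### Schur multipliers of restrictedly bounded kernels -/

theorem SeparatedTestPair.mul {N : ℕ} {f g a b : EuclideanSpace ℝ (Fin N) → ℝ}
    (h : SeparatedTestPair f g) (ha : Measurable a) (hb : Measurable b) (ha1 : ∀ x, |a x| ≤ 1)
    (hb1 : ∀ x, |b x| ≤ 1) :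
    SeparatedTestPair (fun x => f x * a x) (fun x => g x * b x) where
  measurable_left := h.measurable_left.mul ha
  measurable_right := h.measurable_right.mul hb
  bounded_left := by
    obtain ⟨R, hR⟩ := h.bounded_left
    refine ⟨R, fun x => ?_⟩
    rw [abs_mul]
    exact (mul_le_of_le_one_right (abs_nonneg _) (ha1 x)).trans (hR x)
  bounded_right := by
    obtain ⟨R, hR⟩ := h.bounded_right
    refine ⟨R, fun x => ?_⟩
    rw [abs_mul]
    exact (mul_le_of_le_one_right (abs_nonneg _) (hb1 x)).trans (hR x)
  compact_left := h.compact_left.mul_right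
  compact_right := h.compact_right.mul_right
  separated := by
    obtain ⟨δ, hδ, hsep⟩ := h.separated
    exact ⟨δ, hδ, fun x hx y hy => hsep x (tsupport_mul_subset_left hx) y
      (tsupport_mul_subset_left hy)⟩

theorem eLpNorm_mul_le_of_abs_le_one {X : Type*} [MeasurableSpace X] {μ : Measure X} {p : ℝ≥0∞}
    {f a : X → ℝ} (ha : ∀ x, |a x| ≤ 1) : eLpNorm (fun x => f x * a x) p μ ≤ eLpNorm f p μ := by
  refine eLpNorm_mono fun x => ?_
  rw [norm_mul]
  exact mul_le_of_le_one_right (norm_nonneg _) (ha x)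

section TestPair

variable {N m : ℕ} {μ ν : Measure (EuclideanSpace ℝ (Fin N))}
  [IsLocallyFiniteMeasure μ] [IsLocallyFiniteMeasure ν]
  {K : EuclideanSpace ℝ (Fin N) → EuclideanSpace ℝ (Fin N) → EuclideanSpace ℝ (Fin m)}
  {f g : EuclideanSpace ℝ (Fin N) → ℝ}

theorem eLpNorm_ne_top_of_bounded_of_hasCompactSupport (hf : Measurable f)
    (hR : ∃ R : ℝ, ∀ x, |f x| ≤ R) (hc : HasCompactSupport f) (p : ℝ≥0∞) :
    eLpNorm f p μ ≠ ∞ := by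
  obtain ⟨R, hR⟩ := hR
  have hind : (tsupport f).indicator f = f :=
    Set.indicator_eq_self.2 (subset_tsupport f)
  have hfin : IsFiniteMeasure (μ.restrict (tsupport f)) :=
    isFiniteMeasure_restrict.2 hc.measure_lt_top.ne
  rw [← hind, eLpNorm_indicator_eq_eLpNorm_restrict (isClosed_tsupport f).measurableSet]
  exact (MemLp.of_bound hf.aestronglyMeasurable R (ae_of_all _ hR)).eLpNorm_ne_top

/-- The product of the supports is compact and misses the diagonal; there the kernel is `L²` for a
finite measure, hence `L¹`. -/
theorem IsSingularKernel.integrable (hK : IsSingularKernel μ ν K) (h : SeparatedTestPair f g) :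
    Integrable (fun z => (f z.2 * g z.1) • K z.1 z.2) (ν.prod μ) := by
  obtain ⟨R, hR⟩ := h.bounded_left
  obtain ⟨R', hR'⟩ := h.bounded_right
  obtain ⟨δ, hδ, hsep⟩ := h.separated
  set S : Set (EuclideanSpace ℝ (Fin N) × EuclideanSpace ℝ (Fin N)) := tsupport g ×ˢ tsupport f
  have hS : IsCompact S := h.compact_right.isCompact.prod h.compact_left.isCompact
  have hKS := hK.2 S hS (fun z hz heq => by
    have := hsep z.2 hz.2 z.1 hz.1
    rw [heq, dist_self] at this
    exact absurd this (not_le.2 hδ))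
  have : IsFiniteMeasure ((ν.prod μ).restrict S) :=
    isFiniteMeasure_restrict.2 hS.measure_lt_top.ne
  have hsupp : Function.support (fun z : EuclideanSpace ℝ (Fin N) × EuclideanSpace ℝ (Fin N) =>
      (f z.2 * g z.1) • K z.1 z.2) ⊆ S := by
    intro z hz
    have h0 : f z.2 * g z.1 ≠ 0 := left_ne_zero_of_smul hz
    exact ⟨subset_tsupport g (right_ne_zero_of_mul h0), subset_tsupport f (left_ne_zero_of_mul h0)⟩
  rw [← integrableOn_iff_integrable_of_support_subset hsupp]
  refine (hKS.integrable (by norm_num)).bdd_smul (𝕜 := ℝ) (R * R') ?_ (ae_of_all _ fun z => ?_)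
  · exact ((h.measurable_left.comp measurable_snd).mul
      (h.measurable_right.comp measurable_fst)).aestronglyMeasurable
  · rw [Real.norm_eq_abs, abs_mul]
    exact mul_le_mul (hR _) (hR' _) (abs_nonneg _) ((abs_nonneg _).trans (hR z.2))

variable {p q C : ℝ}

theorem norm_integral_mul_smul_le (hK : IsSingularKernel μ ν K) (hC : 0 ≤ C)
    (hbdd : ∀ f g : EuclideanSpace ℝ (Fin N) → ℝ, SeparatedTestPair f g →
      ‖∫ z, (f z.2 * g z.1) • K z.1 z.2 ∂(ν.prod μ)‖ ≤
        C * (eLpNorm f (ENNReal.ofReal p) μ).toReal * (eLpNorm g (ENNReal.ofReal q) ν).toReal)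
    (h : SeparatedTestPair f g) {a b : EuclideanSpace ℝ (Fin N) → ℝ} (ha : Measurable a)
    (hb : Measurable b) (ha1 : ∀ x, |a x| ≤ 1) (hb1 : ∀ x, |b x| ≤ 1) :
    Integrable (fun z => (f z.2 * a z.2 * (g z.1 * b z.1)) • K z.1 z.2) (ν.prod μ) ∧
    ‖∫ z, (f z.2 * a z.2 * (g z.1 * b z.1)) • K z.1 z.2 ∂(ν.prod μ)‖ ≤
      C * (eLpNorm f (ENNReal.ofReal p) μ).toReal * (eLpNorm g (ENNReal.ofReal q) ν).toReal := by
  have hab := h.mul ha hb ha1 hb1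
  have hf := eLpNorm_ne_top_of_bounded_of_hasCompactSupport (μ := μ) h.measurable_left
    h.bounded_left h.compact_left (ENNReal.ofReal p)
  have hg := eLpNorm_ne_top_of_bounded_of_hasCompactSupport (μ := ν) h.measurable_right
    h.bounded_right h.compact_right (ENNReal.ofReal q)
  refine ⟨hK.integrable hab, (hbdd _ _ hab).trans ?_⟩
  gcongr
  · exact eLpNorm_mul_le_of_abs_le_one ha1
  · exact eLpNorm_mul_le_of_abs_le_one hb1

/-- Modulating a kernel by the cosine of a phase difference at most doubles its bound. -/
theorem norm_integral_cos_smul_le (hK : IsSingularKernel μ ν K) (hC : 0 ≤ C)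
    (hbdd : ∀ f g : EuclideanSpace ℝ (Fin N) → ℝ, SeparatedTestPair f g →
      ‖∫ z, (f z.2 * g z.1) • K z.1 z.2 ∂(ν.prod μ)‖ ≤
        C * (eLpNorm f (ENNReal.ofReal p) μ).toReal * (eLpNorm g (ENNReal.ofReal q) ν).toReal)
    (h : SeparatedTestPair f g) {θ : EuclideanSpace ℝ (Fin N) → ℝ} (hθ : Measurable θ) :
    ‖∫ z, Real.cos (θ z.2 - θ z.1) • (f z.2 * g z.1) • K z.1 z.2 ∂(ν.prod μ)‖ ≤
      2 * (C * (eLpNorm f (ENNReal.ofReal p) μ).toReal *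
        (eLpNorm g (ENNReal.ofReal q) ν).toReal) := by
  obtain ⟨hI1, h1⟩ := norm_integral_mul_smul_le hK hC hbdd h hθ.cos hθ.cos
    (fun x => Real.abs_cos_le_one _) (fun x => Real.abs_cos_le_one _)
  obtain ⟨hI2, h2⟩ := norm_integral_mul_smul_le hK hC hbdd h hθ.sin hθ.sin
    (fun x => Real.abs_sin_le_one _) (fun x => Real.abs_sin_le_one _)
  -- The addition formula gives two terms, each factored into a function of `t` and one of `s`;
  -- hence the factor 2.
  have hsplit : ∀ z : EuclideanSpace ℝ (Fin N) × EuclideanSpace ℝ (Fin N),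
      Real.cos (θ z.2 - θ z.1) • (f z.2 * g z.1) • K z.1 z.2 =
      (f z.2 * Real.cos (θ z.2) * (g z.1 * Real.cos (θ z.1))) • K z.1 z.2 +
      (f z.2 * Real.sin (θ z.2) * (g z.1 * Real.sin (θ z.1))) • K z.1 z.2 := by
    intro z
    rw [smul_smul, ← add_smul, Real.cos_sub]
    congr 1
    ring
  simp_rw [hsplit]
  rw [integral_add hI1 hI2, two_mul]
  exact (norm_add_le _ _).trans (add_le_add h1 h2)

/-- Modulating a kernel by the sine of a phase difference at most doubles its bound. -/
theorem norm_integral_sin_smul_le (hK : IsSingularKernel μ ν K) (hC : 0 ≤ C)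
    (hbdd : ∀ f g : EuclideanSpace ℝ (Fin N) → ℝ, SeparatedTestPair f g →
      ‖∫ z, (f z.2 * g z.1) • K z.1 z.2 ∂(ν.prod μ)‖ ≤
        C * (eLpNorm f (ENNReal.ofReal p) μ).toReal * (eLpNorm g (ENNReal.ofReal q) ν).toReal)
    (h : SeparatedTestPair f g) {θ : EuclideanSpace ℝ (Fin N) → ℝ} (hθ : Measurable θ) :
    ‖∫ z, Real.sin (θ z.2 - θ z.1) • (f z.2 * g z.1) • K z.1 z.2 ∂(ν.prod μ)‖ ≤
      2 * (C * (eLpNorm f (ENNReal.ofReal p) μ).toReal *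
        (eLpNorm g (ENNReal.ofReal q) ν).toReal) := by
  obtain ⟨hI1, h1⟩ := norm_integral_mul_smul_le hK hC hbdd h hθ.sin hθ.cos
    (fun x => Real.abs_sin_le_one _) (fun x => Real.abs_cos_le_one _)
  obtain ⟨hI2, h2⟩ := norm_integral_mul_smul_le hK hC hbdd h hθ.cos hθ.sin
    (fun x => Real.abs_cos_le_one _) (fun x => Real.abs_sin_le_one _)
  have hsplit : ∀ z : EuclideanSpace ℝ (Fin N) × EuclideanSpace ℝ (Fin N),
      Real.sin (θ z.2 - θ z.1) • (f z.2 * g z.1) • K z.1 z.2 =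
      (f z.2 * Real.sin (θ z.2) * (g z.1 * Real.cos (θ z.1))) • K z.1 z.2 -
      (f z.2 * Real.cos (θ z.2) * (g z.1 * Real.sin (θ z.1))) • K z.1 z.2 := by
    intro z
    rw [smul_smul, ← sub_smul, Real.sin_sub]
    congr 1
    ring
  simp_rw [hsplit]
  rw [integral_sub hI1 hI2, two_mul]
  exact (norm_sub_le _ _).trans (add_le_add h1 h2)

/-- Inverse Fourier transforms of integrable functions are Schur multipliers, uniformly in
dilations. -/
theorem norm_integral_fourierInv_smul_le (hK : IsSingularKernel μ ν K) (hC : 0 ≤ C)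
    (hbdd : ∀ f g : EuclideanSpace ℝ (Fin N) → ℝ, SeparatedTestPair f g →
      ‖∫ z, (f z.2 * g z.1) • K z.1 z.2 ∂(ν.prod μ)‖ ≤
        C * (eLpNorm f (ENNReal.ofReal p) μ).toReal * (eLpNorm g (ENNReal.ofReal q) ν).toReal)
    (h : SeparatedTestPair f g) {v : EuclideanSpace ℝ (Fin N) → ℂ} (hv : Integrable v)
    {φ : EuclideanSpace ℝ (Fin N) → ℝ}
    (hφ : FourierTransformInv.fourierInv v = fun x => (φ x : ℂ)) (c : ℝ) :
    ‖∫ z, φ (c • (z.2 - z.1)) • (f z.2 * g z.1) • K z.1 z.2 ∂(ν.prod μ)‖ ≤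
      (4 * ∫ ξ, ‖v ξ‖) * (C * (eLpNorm f (ENNReal.ofReal p) μ).toReal *
        (eLpNorm g (ENNReal.ofReal q) ν).toReal) := by
  set M := C * (eLpNorm f (ENNReal.ofReal p) μ).toReal * (eLpNorm g (ENNReal.ofReal q) ν).toReal
  set H : EuclideanSpace ℝ (Fin N) × EuclideanSpace ℝ (Fin N) → EuclideanSpace ℝ (Fin m) :=
    fun z => (f z.2 * g z.1) • K z.1 z.2
  have hH : Integrable H (ν.prod μ) := hK.integrable h
  -- The phase is linear in `x`, and `c` enters only through it, so the bound does not depend on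
  -- `c`.
  set θ : EuclideanSpace ℝ (Fin N) → EuclideanSpace ℝ (Fin N) → ℝ :=
    fun ξ x => 2 * Real.pi * inner ℝ ξ (c • x)
  have hθ : ∀ ξ, Continuous (θ ξ) := fun ξ => by fun_prop
  have hθsub : ∀ ξ s t, 2 * Real.pi * inner ℝ ξ (c • (t - s)) = θ ξ t - θ ξ s := fun ξ s t => by
    simp only [θ, smul_sub, inner_sub_right, mul_sub]
  set w : EuclideanSpace ℝ (Fin N) × EuclideanSpace ℝ (Fin N) → EuclideanSpace ℝ (Fin N) → ℝ :=
    fun z ξ => (v ξ).re * Real.cos (θ ξ z.2 - θ ξ z.1) - (v ξ).im * Real.sin (θ ξ z.2 - θ ξ z.1)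
  have hφw : ∀ z : EuclideanSpace ℝ (Fin N) × EuclideanSpace ℝ (Fin N),
      φ (c • (z.2 - z.1)) = ∫ ξ, w z ξ := fun z => by
    rw [ofReal_eq_fourierInv hv (congrFun hφ (c • (z.2 - z.1)))]
    simp_rw [hθsub]
    rfl
  have hint : Integrable (Function.uncurry fun z ξ => w z ξ • H z) ((ν.prod μ).prod volume) := by
    have hdom : Integrable (fun a : (EuclideanSpace ℝ (Fin N) × EuclideanSpace ℝ (Fin N)) ×
        EuclideanSpace ℝ (Fin N) => ‖H a.1‖ • (2 * ‖v a.2‖)) ((ν.prod μ).prod volume) :=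
      hH.norm.smul_prod (hv.norm.const_mul 2)
    refine hdom.mono ?_ (ae_of_all _ fun a => ?_)
    · have hHm : AEStronglyMeasurable (fun a : (EuclideanSpace ℝ (Fin N) ×
        EuclideanSpace ℝ (Fin N)) × EuclideanSpace ℝ (Fin N) => H a.1)
          ((ν.prod μ).prod volume) := hH.aestronglyMeasurable.comp_fst
      suffices hw : AEStronglyMeasurable (fun a : (EuclideanSpace ℝ (Fin N) ×
        EuclideanSpace ℝ (Fin N)) × EuclideanSpace ℝ (Fin N) => w a.1 a.2)
          ((ν.prod μ).prod volume) from hw.smul hHm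
      have hvm : AEStronglyMeasurable (fun a : (EuclideanSpace ℝ (Fin N) ×
        EuclideanSpace ℝ (Fin N)) × EuclideanSpace ℝ (Fin N) => v a.2)
          ((ν.prod μ).prod volume) := hv.aestronglyMeasurable.comp_snd (μ := ν.prod μ)
      have hcont : Continuous fun a : (EuclideanSpace ℝ (Fin N) ×
        EuclideanSpace ℝ (Fin N)) × EuclideanSpace ℝ (Fin N) =>
          θ a.2 a.1.2 - θ a.2 a.1.1 := by fun_prop
      exact ((Complex.continuous_re.comp_aestronglyMeasurable hvm).mul
        (Real.continuous_cos.comp hcont).aestronglyMeasurable).sub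
        ((Complex.continuous_im.comp_aestronglyMeasurable hvm).mul
        (Real.continuous_sin.comp hcont).aestronglyMeasurable)
    · have hw : ‖w a.1 a.2‖ ≤ 2 * ‖v a.2‖ := by
        refine (norm_sub_le _ _).trans ?_
        rw [norm_mul, norm_mul, two_mul]
        exact add_le_add
          ((mul_le_of_le_one_right (norm_nonneg _) (Real.abs_cos_le_one _)).trans
            (Complex.abs_re_le_norm _))
          ((mul_le_of_le_one_right (norm_nonneg _) (Real.abs_sin_le_one _)).trans
            (Complex.abs_im_le_norm _))
      simp only [Function.uncurry, norm_smul, norm_norm, Real.norm_ofNat, norm_mul]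
      rw [mul_comm]
      gcongr
  have hswap : ∫ z, φ (c • (z.2 - z.1)) • H z ∂(ν.prod μ) =
      ∫ ξ, ∫ z, w z ξ • H z ∂(ν.prod μ) := by
    rw [← integral_integral_swap hint]
    refine integral_congr_ae (ae_of_all _ fun z => ?_)
    simp only [hφw, integral_smul_const]
  rw [hswap]
  have hM : 0 ≤ M := by positivity
  -- 4 is 2 for the real and imaginary parts times 2 for each modulation.
  have hinner : ∀ ξ, ‖∫ z, w z ξ • H z ∂(ν.prod μ)‖ ≤ (4 * M) * ‖v ξ‖ := by
    intro ξ
    have hsm : ∀ u : EuclideanSpace ℝ (Fin N) × EuclideanSpace ℝ (Fin N) → ℝ, Continuous u →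
        AEStronglyMeasurable u (ν.prod μ) := fun u hu => hu.aestronglyMeasurable
    have hcosI : Integrable (fun z => Real.cos (θ ξ z.2 - θ ξ z.1) • H z) (ν.prod μ) :=
      hH.bdd_smul (𝕜 := ℝ) 1 (hsm _ (by fun_prop)) (ae_of_all _ fun z => Real.abs_cos_le_one _)
    have hsinI : Integrable (fun z => Real.sin (θ ξ z.2 - θ ξ z.1) • H z) (ν.prod μ) :=
      hH.bdd_smul (𝕜 := ℝ) 1 (hsm _ (by fun_prop)) (ae_of_all _ fun z => Real.abs_sin_le_one _)
    have e : ∫ z, w z ξ • H z ∂(ν.prod μ) =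
        (v ξ).re • ∫ z, Real.cos (θ ξ z.2 - θ ξ z.1) • H z ∂(ν.prod μ) -
        (v ξ).im • ∫ z, Real.sin (θ ξ z.2 - θ ξ z.1) • H z ∂(ν.prod μ) := by
      rw [← integral_smul, ← integral_smul, ← integral_sub (hcosI.fun_smul _) (hsinI.fun_smul _)]
      simp only [w, sub_smul, mul_smul]
    rw [e]
    refine (norm_sub_le _ _).trans ?_
    rw [norm_smul, norm_smul]
    have h1 := mul_le_mul (Complex.abs_re_le_norm (v ξ))
      (norm_integral_cos_smul_le hK hC hbdd h (hθ ξ).measurable) (norm_nonneg _) (norm_nonneg _)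
    have h2 := mul_le_mul (Complex.abs_im_le_norm (v ξ))
      (norm_integral_sin_smul_le hK hC hbdd h (hθ ξ).measurable) (norm_nonneg _) (norm_nonneg _)
    refine (add_le_add h1 h2).trans (le_of_eq ?_)
    simp only [M]
    ring
  refine (norm_integral_le_of_norm_le (hv.norm.const_mul _) (ae_of_all _ hinner)).trans
    (le_of_eq ?_)
  rw [integral_const_mul]
  ring

end TestPair

/-! ### Testing on disjoint compact sets -/

theorem separatedTestPair_indicator {N : ℕ} {E F : Set (EuclideanSpace ℝ (Fin N))}
    (hE : IsCompact E) (hF : IsCompact F) (hd : Disjoint E F) :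
    SeparatedTestPair (E.indicator fun _ => 1) (F.indicator fun _ => 1) := by
  have hts : ∀ {Q : Set (EuclideanSpace ℝ (Fin N))}, IsCompact Q →
      tsupport (Q.indicator fun _ => (1 : ℝ)) ⊆ Q := fun hQ =>
    closure_minimal Set.support_indicator_subset hQ.isClosed
  have hb : ∀ (Q : Set (EuclideanSpace ℝ (Fin N))) x,
      |Q.indicator (fun _ => (1 : ℝ)) x| ≤ 1 := fun Q x => by
    by_cases hx : x ∈ Q <;> simp [hx]
  obtain ⟨δ, hδ, hdis⟩ := hd.exists_thickenings hE hF.isClosed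
  exact
    { measurable_left := measurable_const.indicator hE.measurableSet
      measurable_right := measurable_const.indicator hF.measurableSet
      bounded_left := ⟨1, hb E⟩
      bounded_right := ⟨1, hb F⟩
      compact_left := hE.of_isClosed_subset (isClosed_tsupport _) (hts hE)
      compact_right := hF.of_isClosed_subset (isClosed_tsupport _) (hts hF)
      separated := by
        refine ⟨δ, hδ, fun x hx y hy => ?_⟩
        by_contra! hlt
        exact Set.disjoint_left.1 hdis
          (Metric.mem_thickening_iff.2 ⟨x, hts hE hx, by rwa [dist_comm]⟩)
          (Metric.self_subset_thickening hδ F (hts hF hy)) }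

theorem toReal_eLpNorm_indicator_one {X : Type*} [MeasurableSpace X] {μ : Measure X} {p : ℝ}
    (hp : 0 < p) {Q : Set X} (hQ : MeasurableSet Q) :
    (eLpNorm (Q.indicator fun _ => (1 : ℝ)) (ENNReal.ofReal p) μ).toReal =
      (μ Q).toReal ^ (1 / p) := by
  rw [eLpNorm_indicator_const hQ (by simpa using hp) (by simp), ENNReal.toReal_ofReal hp.le]
  simp [ENNReal.toReal_rpow]

/-- A homogeneous kernel times a dilate of its angular part is bounded below near the diagonal. -/
theorem sum_mul_kernel_ge {N m : ℕ} {d α b D : ℝ} (hα : d ≤ α) {A : ℝ → ℝ}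
    (hA : ∀ x : ℝ, 0 < x → x ^ (-d - α) ≤ A x)
    {B : EuclideanSpace ℝ (Fin N) → EuclideanSpace ℝ (Fin m)}
    (hB_hom : ∀ (x : EuclideanSpace ℝ (Fin N)) (c : ℝ), 0 < c → B (c • x) = c ^ d • B x)
    (hb : 0 < b) (hB_low : ∀ x : EuclideanSpace ℝ (Fin N), ‖x‖ = 1 → b ≤ ‖B x‖)
    {u : EuclideanSpace ℝ (Fin N)} (hu : u ≠ 0) (hD : 0 < D) (huD : ‖u‖ ≤ D) :
    b ^ 2 * D ^ (-α) ≤ ∑ j, B (D⁻¹ • u) j * (A ‖u‖ • B u) j := by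
  have hu0 : 0 < ‖u‖ := norm_pos_iff.2 hu
  have hlow : ‖u‖ ^ d * b ≤ ‖B u‖ := by
    have h1 : B u = ‖u‖ ^ d • B (‖u‖⁻¹ • u) := by
      rw [← hB_hom _ _ hu0, smul_inv_smul₀ hu0.ne']
    rw [h1, norm_smul, Real.norm_of_nonneg (by positivity)]
    gcongr
    exact hB_low _ (by rw [norm_smul, norm_inv, norm_norm, inv_mul_cancel₀ hu0.ne'])
  have hsum : ∑ j, B (D⁻¹ • u) j * (A ‖u‖ • B u) j = A ‖u‖ * D ^ (-d) * ‖B u‖ ^ 2 := by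
    rw [hB_hom _ _ (inv_pos.2 hD), EuclideanSpace.norm_sq_eq, Finset.mul_sum,
      Real.inv_rpow hD.le, ← Real.rpow_neg hD.le]
    refine Finset.sum_congr rfl fun j _ => ?_
    simp only [PiLp.smul_apply, smul_eq_mul, Real.norm_eq_abs, sq_abs]
    ring
  rw [hsum]
  calc b ^ 2 * D ^ (-α) = D ^ (d - α) * D ^ (-d) * b ^ 2 := by
        rw [← Real.rpow_add hD]
        ring_nf
    -- Here `α ≥ d` is used: the power `d - α` is nonpositive.
    _ ≤ ‖u‖ ^ (d - α) * D ^ (-d) * b ^ 2 := by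
        gcongr ?_ * _ * _
        exact Real.rpow_le_rpow_of_nonpos hu0 huD (by linarith)
    _ = ‖u‖ ^ (-d - α) * D ^ (-d) * (‖u‖ ^ d * b) ^ 2 := by
        have : ‖u‖ ^ (d - α) = ‖u‖ ^ (-d - α) * (‖u‖ ^ d * ‖u‖ ^ d) := by
          rw [← Real.rpow_add hu0, ← Real.rpow_add hu0]
          ring_nf
        rw [this]
        ring
    _ ≤ A ‖u‖ * D ^ (-d) * ‖B u‖ ^ 2 := by
        have h0 : 0 ≤ A ‖u‖ := (Real.rpow_nonneg hu0.le _).trans (hA _ hu0)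
        gcongr
        exact hA _ hu0

/-- The testing inequality for a restrictedly bounded homogeneous kernel on disjoint compact sets
of diameter at most `D`. -/
theorem mul_measure_mul_measure_le {N m : ℕ} {p q d α b C D : ℝ} (hp : 0 < p) (hq : 0 < q)
    (hα : d ≤ α) {A : ℝ → ℝ} (hA : ∀ x : ℝ, 0 < x → x ^ (-d - α) ≤ A x)
    {B : EuclideanSpace ℝ (Fin N) → EuclideanSpace ℝ (Fin m)} (hB_cont : Continuous B)
    (hB_hom : ∀ (x : EuclideanSpace ℝ (Fin N)) (c : ℝ), 0 < c → B (c • x) = c ^ d • B x)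
    (hb : 0 < b) (hB_low : ∀ x : EuclideanSpace ℝ (Fin N), ‖x‖ = 1 → b ≤ ‖B x‖)
    {χ : EuclideanSpace ℝ (Fin N) → ℝ} (hχ : Continuous χ) (hχc : HasCompactSupport χ)
    (hχ1 : ∀ x, ‖x‖ ≤ 1 → χ x = 1) {v : Fin m → EuclideanSpace ℝ (Fin N) → ℂ}
    (hv : ∀ j, Integrable (v j))
    (hvB : ∀ j, FourierTransformInv.fourierInv (v j) = fun x => ((χ x * B x j : ℝ) : ℂ))
    {μ ν : Measure (EuclideanSpace ℝ (Fin N))}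
    [IsLocallyFiniteMeasure μ] [IsLocallyFiniteMeasure ν]
    (hK : IsSingularKernel μ ν (fun s t => A ‖t - s‖ • B (t - s))) (hC : 0 ≤ C)
    (hbdd : ∀ f g : EuclideanSpace ℝ (Fin N) → ℝ, SeparatedTestPair f g →
      ‖∫ z, (f z.2 * g z.1) • (A ‖z.2 - z.1‖ • B (z.2 - z.1)) ∂(ν.prod μ)‖ ≤
        C * (eLpNorm f (ENNReal.ofReal p) μ).toReal * (eLpNorm g (ENNReal.ofReal q) ν).toReal)
    {E F : Set (EuclideanSpace ℝ (Fin N))} (hE : IsCompact E) (hF : IsCompact F)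
    (hdis : Disjoint E F) (hD : 0 < D) (hED : ∀ s ∈ F, ∀ t ∈ E, ‖t - s‖ ≤ D) :
    b ^ 2 * D ^ (-α) * ((μ E).toReal * (ν F).toReal) ≤
      (∑ j, 4 * ∫ ξ, ‖v j ξ‖) * (C * (μ E).toReal ^ (1 / p) * (ν F).toReal ^ (1 / q)) := by
  set f : EuclideanSpace ℝ (Fin N) → ℝ := E.indicator fun _ => 1
  set g : EuclideanSpace ℝ (Fin N) → ℝ := F.indicator fun _ => 1
  have hfg : SeparatedTestPair f g := separatedTestPair_indicator hE hF hdis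
  set H : EuclideanSpace ℝ (Fin N) × EuclideanSpace ℝ (Fin N) → EuclideanSpace ℝ (Fin m) :=
    fun z => (f z.2 * g z.1) • (A ‖z.2 - z.1‖ • B (z.2 - z.1))
  have hH : Integrable H (ν.prod μ) := hK.integrable hfg
  -- On `F ×ˢ E` the rescaled difference lies in the unit ball, where the cut-off is 1, so `φ j`
  -- equals `B_j` there.
  set φ : Fin m → EuclideanSpace ℝ (Fin N) → ℝ := fun j x => χ x * B x j
  have hφ : ∀ j, Continuous (φ j) := fun j => by fun_prop
  have hφc : ∀ j, HasCompactSupport (φ j) := fun j => hχc.mul_right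
  have hI : ∀ j, Integrable (fun z => φ j (D⁻¹ • (z.2 - z.1)) • H z) (ν.prod μ) := fun j => by
    obtain ⟨R, hR⟩ := (hφc j).exists_bound_of_continuous (hφ j)
    have hcont : Continuous fun z : EuclideanSpace ℝ (Fin N) × EuclideanSpace ℝ (Fin N) =>
      φ j (D⁻¹ • (z.2 - z.1)) := (hφ j).comp (by fun_prop)
    exact hH.bdd_smul (𝕜 := ℝ) R hcont.aestronglyMeasurable (ae_of_all _ fun z => hR _)
  have hIj : ∀ j, Integrable (fun z => φ j (D⁻¹ • (z.2 - z.1)) * H z j) (ν.prod μ) := fun j =>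
    (EuclideanSpace.proj (𝕜 := ℝ) j).integrable_comp (hI j)
  have hupper : ∀ j, ∫ z, φ j (D⁻¹ • (z.2 - z.1)) * H z j ∂(ν.prod μ) ≤
      (4 * ∫ ξ, ‖v j ξ‖) * (C * (μ E).toReal ^ (1 / p) * (ν F).toReal ^ (1 / q)) := fun j => by
    have h1 := norm_integral_fourierInv_smul_le hK hC hbdd hfg (hv j) (hvB j) D⁻¹
    rw [toReal_eLpNorm_indicator_one hp hE.measurableSet,
      toReal_eLpNorm_indicator_one hq hF.measurableSet] at h1
    refine le_trans ?_ h1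
    have h2 := (EuclideanSpace.proj (𝕜 := ℝ) j).integral_comp_comm (hI j)
    exact ((le_abs_self _).trans_eq (congrArg abs h2)).trans
      (PiLp.norm_apply_le (∫ z, φ j (D⁻¹ • (z.2 - z.1)) • H z ∂(ν.prod μ)) j)
  have hlower : ∀ z : EuclideanSpace ℝ (Fin N) × EuclideanSpace ℝ (Fin N),
      (F ×ˢ E).indicator (fun _ => b ^ 2 * D ^ (-α)) z ≤
        ∑ j, φ j (D⁻¹ • (z.2 - z.1)) * H z j := by
    intro z
    by_cases hz : z ∈ F ×ˢ E
    · obtain ⟨hz1, hz2⟩ := hz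
      have hne : z.2 - z.1 ≠ 0 := fun h0 =>
        Set.disjoint_left.1 hdis hz2 (by rwa [sub_eq_zero.1 h0])
      have hle := hED _ hz1 _ hz2
      have hχz : χ (D⁻¹ • (z.2 - z.1)) = 1 := hχ1 _ (by
        rw [norm_smul, norm_inv, Real.norm_of_nonneg hD.le]
        exact inv_mul_le_one_of_le₀ hle hD.le)
      rw [Set.indicator_of_mem (Set.mk_mem_prod hz1 hz2)]
      refine (sum_mul_kernel_ge hα hA hB_hom hb hB_low hne hD hle).trans_eq ?_
      refine Finset.sum_congr rfl fun j _ => ?_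
      simp only [φ, H, hχz, f, g, Set.indicator_of_mem hz1, Set.indicator_of_mem hz2, one_mul,
        one_smul]
    · have h0 : f z.2 * g z.1 = 0 := by
        by_cases hz1 : z.1 ∈ F
        · have hz2 : z.2 ∉ E := fun h => hz ⟨hz1, h⟩
          simp [f, hz2]
        · simp [g, hz1]
      rw [Set.indicator_of_notMem hz]
      simp [H, h0]
  have hmeas : MeasurableSet (F ×ˢ E) := hF.measurableSet.prod hE.measurableSet
  have hfin : (ν.prod μ) (F ×ˢ E) ≠ ∞ := (hF.prod hE).measure_lt_top.ne
  calc b ^ 2 * D ^ (-α) * ((μ E).toReal * (ν F).toReal)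
      = ∫ z, (F ×ˢ E).indicator (fun _ => b ^ 2 * D ^ (-α)) z ∂(ν.prod μ) := by
        rw [integral_indicator_const _ hmeas, measureReal_def, Measure.prod_prod,
          ENNReal.toReal_mul, smul_eq_mul]
        ring
    _ ≤ ∫ z, ∑ j, φ j (D⁻¹ • (z.2 - z.1)) * H z j ∂(ν.prod μ) :=
        integral_mono ((integrable_indicator_iff hmeas).2 (integrableOn_const hfin))
          (integrable_finsetSum _ fun j _ => hIj j) hlower
    _ = ∑ j, ∫ z, φ j (D⁻¹ • (z.2 - z.1)) * H z j ∂(ν.prod μ) :=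
        integral_finsetSum _ fun j _ => hIj j
    _ ≤ _ := by
        rw [Finset.sum_mul]
        exact Finset.sum_le_sum fun j _ => hupper j

/-- Dividing the testing inequality by `x ^ (1 / p) * y ^ (1 / q)`. -/
theorem Real.mul_rpow_mul_rpow_le_of_holderConjugate {p q b a T x y : ℝ}
    (hpq : p.HolderConjugate q) (hb : 0 < b) (hx : 0 ≤ x) (hy : 0 ≤ y) (hT : 0 ≤ T)
    (h : b * a * (x * y) ≤ T * (x ^ (1 / p) * y ^ (1 / q))) :
    a * x ^ (1 / q) * y ^ (1 / p) ≤ T / b := by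
  have hp := hpq.pos
  have hq := hpq.symm.pos
  have hsum : 1 / p + 1 / q = 1 := by simpa using hpq.inv_add_inv_eq_one
  rcases hx.eq_or_lt with rfl | hx
  · rw [Real.zero_rpow (by positivity)]
    simp only [mul_zero, zero_mul]
    positivity
  rcases hy.eq_or_lt with rfl | hy
  · rw [Real.zero_rpow (by positivity)]
    simp only [mul_zero]
    positivity
  have ex : x = x ^ (1 / p) * x ^ (1 / q) := by rw [← Real.rpow_add hx, hsum, Real.rpow_one]
  have ey : y = y ^ (1 / p) * y ^ (1 / q) := by rw [← Real.rpow_add hy, hsum, Real.rpow_one]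
  have hpos : 0 < x ^ (1 / p) * y ^ (1 / q) := by positivity
  rw [le_div_iff₀ hb]
  refine le_of_mul_le_mul_right ?_ hpos
  calc _ = b * a * ((x ^ (1 / p) * x ^ (1 / q)) * (y ^ (1 / p) * y ^ (1 / q))) := by ring
    _ ≤ _ := by rwa [← ex, ← ey]

/-! ### The bound over balls -/

theorem theorem5p1 {N m : ℕ} (p p' : ℝ) (hp : p.HolderConjugate p')
    (k d α : ℝ) (hk : (N : ℝ) / 2 < k) (hd : 0 < d) (hα : d ≤ α)
    (A : ℝ → ℝ) (hA : ∀ x : ℝ, 0 < x → x ^ (-d - α) ≤ A x)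
    (B : EuclideanSpace ℝ (Fin N) → EuclideanSpace ℝ (Fin m))
    (hB_cont : Continuous B)
    (hB_sob : ∀ j : Fin m, MemSobolevLoc k (fun x => B x j))
    (hB_hom : ∀ (x : EuclideanSpace ℝ (Fin N)) (c : ℝ), 0 < c → B (c • x) = c ^ d • B x)
    (hB_low : ∃ b : ℝ, 0 < b ∧ ∀ x : EuclideanSpace ℝ (Fin N), ‖x‖ = 1 → b ≤ ‖B x‖)
    (μ ν : Measure (EuclideanSpace ℝ (Fin N)))
    [IsLocallyFiniteMeasure μ] [IsLocallyFiniteMeasure ν]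
    (hatoms : ∀ x : EuclideanSpace ℝ (Fin N), μ {x} = 0 ∨ ν {x} = 0)
    (hK_sing : IsSingularKernel μ ν (fun s t => A ‖t - s‖ • B (t - s)))
    (hK_bdd : RestrictedlyBounded p p' μ ν (fun s t => A ‖t - s‖ • B (t - s))) :
    (⨆ (x : EuclideanSpace ℝ (Fin N)) (r : ℝ) (_ : 0 < r),
      ENNReal.ofReal (Metric.diam (Metric.ball x r)) ^ (-α) *
        μ (Metric.ball x r) ^ (1 / p') * ν (Metric.ball x r) ^ (1 / p)) < ∞ := by
  obtain ⟨b, hb, hlow⟩ := hB_low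
  obtain ⟨C₀, hC₀⟩ := hK_bdd
  have hp0 := hp.pos
  have hq0 := hp.symm.pos
  have hsum : 1 / p' + 1 / p = 1 := by simpa using hp.symm.inv_add_inv_eq_one
  set C := max C₀ 0
  have hC : 0 ≤ C := le_max_right _ _
  have hbdd : ∀ f g : EuclideanSpace ℝ (Fin N) → ℝ, SeparatedTestPair f g →
      ‖∫ z, (f z.2 * g z.1) • (A ‖z.2 - z.1‖ • B (z.2 - z.1)) ∂(ν.prod μ)‖ ≤
        C * (eLpNorm f (ENNReal.ofReal p) μ).toReal *
          (eLpNorm g (ENNReal.ofReal p') ν).toReal := fun f g h => by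
    refine (hC₀ f g h).trans ?_
    gcongr
    exact le_max_left _ _
  let χ : ContDiffBump (0 : EuclideanSpace ℝ (Fin N)) := ⟨1, 2, one_pos, one_lt_two⟩
  have hv : ∀ j, ∃ v : EuclideanSpace ℝ (Fin N) → ℂ, Integrable v ∧
      FourierTransformInv.fourierInv v = fun x => ((χ x * B x j : ℝ) : ℂ) := fun j => by
    obtain ⟨h2, hs⟩ := hB_sob j χ χ.contDiff χ.hasCompactSupport
    have hχ : Continuous χ := χ.continuous
    exact exists_integrable_fourierInv_eq hk (by fun_prop) h2 hs
  choose v hvi hvB using hv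
  set T := (∑ j, 4 * ∫ ξ, ‖v j ξ‖) * C
  have hT : 0 ≤ T :=
    mul_nonneg (Finset.sum_nonneg fun j _ => by positivity) hC
  refine lt_of_le_of_lt (iSup_le fun x => iSup_le fun r => iSup_le fun hr => ?_)
    (ENNReal.ofReal_lt_top (r := 4 * (T / b ^ 2)))
  -- Diameter zero (only for `N = 0`) makes the first factor `∞`, but one measure misses the point
  -- and `∞ * 0 = 0`.
  rcases (Metric.diam_nonneg (s := Metric.ball x r)).eq_or_lt with h0 | hD
  · have hball : Metric.ball x r ⊆ {x} := fun y hy => by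
      have := Metric.dist_le_diam_of_mem Metric.isBounded_ball hy (Metric.mem_ball_self hr)
      rw [← h0] at this
      exact dist_le_zero.1 this
    rcases hatoms x with h | h
    · simp [measure_mono_null hball h, hq0]
    · simp [measure_mono_null hball h, hp0]
  set D := Metric.diam (Metric.ball x r)
  obtain ⟨E, F, hE, hF, hdis, hEs, hFs, h4E, h4F⟩ := exists_disjoint_isCompact_measure_le_four_mul
    μ ν (measurableSet_ball (x := x) (ε := r)) measure_ball_lt_top.ne measure_ball_lt_top.ne hatoms
  have hmain := mul_measure_mul_measure_le hp0 hq0 hα hA hB_cont hB_hom hb hlow χ.continuous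
    χ.hasCompactSupport (fun y hy => χ.one_of_mem_closedBall (by simpa [χ] using hy)) hvi hvB
    hK_sing hC hbdd hE hF hdis hD (fun s hs t ht => by
      rw [← dist_eq_norm]
      exact Metric.dist_le_diam_of_mem Metric.isBounded_ball (hEs ht) (hFs hs))
  have hdiv := Real.mul_rpow_mul_rpow_le_of_holderConjugate hp (pow_pos hb 2)
    ENNReal.toReal_nonneg ENNReal.toReal_nonneg hT (hmain.trans_eq (by ring))
  calc ENNReal.ofReal D ^ (-α) * μ (Metric.ball x r) ^ (1 / p') * ν (Metric.ball x r) ^ (1 / p)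
      ≤ ENNReal.ofReal D ^ (-α) * (4 * μ E) ^ (1 / p') * (4 * ν F) ^ (1 / p) := by gcongr
    _ = 4 * (ENNReal.ofReal D ^ (-α) * μ E ^ (1 / p') * ν F ^ (1 / p)) := by
        rw [ENNReal.mul_rpow_of_nonneg _ _ (by positivity),
          ENNReal.mul_rpow_of_nonneg _ _ (by positivity)]
        -- As the exponents sum to 1, the two losses of 4 combine to a single 4.
        have h4 : (4 : ℝ≥0∞) = 4 ^ (1 / p') * 4 ^ (1 / p) := by
          rw [← ENNReal.rpow_add _ _ (by simp) (by simp), hsum, ENNReal.rpow_one]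
        conv_rhs => rw [h4]
        ring
    _ = ENNReal.ofReal (4 * (D ^ (-α) * (μ E).toReal ^ (1 / p') * (ν F).toReal ^ (1 / p))) := by
        rw [ENNReal.ofReal_mul (by norm_num), ENNReal.ofReal_mul (by positivity),
          ENNReal.ofReal_mul (by positivity), ENNReal.ofReal_rpow_of_pos hD,
          ← ENNReal.ofReal_rpow_of_nonneg ENNReal.toReal_nonneg (by positivity),
          ← ENNReal.ofReal_rpow_of_nonneg ENNReal.toReal_nonneg (by positivity),
          ENNReal.ofReal_toReal hE.measure_lt_top.ne, ENNReal.ofReal_toReal hF.measure_lt_top.ne,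
          ENNReal.ofReal_ofNat]
    _ ≤ _ := by gcongr
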